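/- Let $m,n\ge 1$, $k=\min(m,n)$, and let $M^\star\in\mathbb{R}^{m\times n}$ have singular values $\sigma_1\ge\sigma_2\ge\dots\ge\sigma_k\ge 0$ (counted with multiplicity). Let $\|\cdot\|_F$ be the Frobenius norm and $\|\cdot\|_\star$ the nuclear norm (the sum of the $k$ singular values), and put $$\Phi(W)=\tfrac14\|W-2M^\star\|_F^2+\tfrac1{4k}\|W\|_\star^2,\qquad W\in\mathbb{R}^{m\times n}.$$ Then $\Phi$ has a unique global minimizer $W^\star$, and $W^\star=M^\star$ if and only if $\sigma_1=\sigma_2=\dots=\sigma_k$. For $S\subseteq\{1,\dots,k\}$ let $\Pi_S$ be the $k\times k$ diagonal matrix whose $i$-th diagonal entry is $1$ if $i\in S$ and $0$ otherwise. Every global minimizer $(U,V)\in\mathbb{R}^{m\times k}\times\mathbb{R}^{n\times k}$ of the all-subspaces-learning (ASL) objective $$\frac1{2^k-1}\sum_{\emptyset\ne S\subseteq\{1,\dots,k\}}\|U\Pi_SV^\top-M^\star\|_F^2$$ satisfies $\|UV^\top-M^\star\|_F^2=\|W^\star-M^\star\|_F^2$. Consequently, if $k\ge 2$ and $\sigma_1>\sigma_2>\dots>\sigma_k$,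 then every global minimizer $(U,V)$ of the ASL objective satisfies $$\|UV^\top-M^\star\|_F^2=\|W^\star-M^\star\|_F^2>0.$$ -/

import Mathlib

attribute [local instance] Matrix.frobeniusNormedAddCommGroup

noncomputable section

namespace ElasticRank

/-- The `i`-th singular value of a real `m × n` matrix, counted from `i = 0`, in decreasing order and
with multiplicity; the singular values of the matrix are those with `i < min m n`. -/
def singularValue {m n : ℕ} (A : Matrix (Fin m) (Fin n) ℝ) (i : ℕ) : ℝ :=
  (Matrix.toEuclideanLin A).singularValues i

/-- The nuclear norm: the sum of the `min m n` singular values. -/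
def nuclearNorm {m n : ℕ} (A : Matrix (Fin m) (Fin n) ℝ) : ℝ :=
  ∑ i ∈ Finset.range (min m n), singularValue A i

/-- The objective `Φ(W) = ¼ ‖W - 2 M‖_F² + (1 / (4 k)) ‖W‖_*²` with `k = min m n`.
The norm on matrices is the Frobenius norm. -/
def Phi {m n : ℕ} (M W : Matrix (Fin m) (Fin n) ℝ) : ℝ :=
  (1 / 4) * ‖W - (2 : ℝ) • M‖ ^ 2 + (1 / (4 * ((min m n : ℕ) : ℝ))) * nuclearNorm W ^ 2

/-- The diagonal coordinate projector `Π_S` onto the coordinates in `S`. -/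
def mask {k : ℕ} (S : Finset (Fin k)) : Matrix (Fin k) (Fin k) ℝ :=
  Matrix.diagonal fun i => if i ∈ S then 1 else 0

/-- The all-subspaces-learning objective: the mean of `‖U Π_S Vᵀ - M‖_F²` over all nonempty
`S ⊆ [k]`. -/
def aslObjective {m n k : ℕ} (M : Matrix (Fin m) (Fin n) ℝ)
    (U : Matrix (Fin m) (Fin k) ℝ) (V : Matrix (Fin n) (Fin k) ℝ) : ℝ :=
  (1 / ((2 : ℝ) ^ k - 1)) *
    ∑ S ∈ (Finset.univ : Finset (Finset (Fin k))).filter (fun S => S.Nonempty),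
      ‖U * mask S * V.transpose - M‖ ^ 2

/-- `W` is a global minimizer of `Φ`. -/
def IsPhiMinimizer {m n : ℕ} (M W : Matrix (Fin m) (Fin n) ℝ) : Prop :=
  ∀ W' : Matrix (Fin m) (Fin n) ℝ, Phi M W ≤ Phi M W'

/-- `(U, V)` is a global minimizer of the all-subspaces-learning objective. -/
def IsASLMinimizer {m n k : ℕ} (M : Matrix (Fin m) (Fin n) ℝ)
    (U : Matrix (Fin m) (Fin k) ℝ) (V : Matrix (Fin n) (Fin k) ℝ) : Prop :=
  ∀ (U' : Matrix (Fin m) (Fin k) ℝ) (V' : Matrix (Fin n) (Fin k) ℝ),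
    aslObjective M U V ≤ aslObjective M U' V'

end ElasticRank

end

open Matrix

namespace ElasticRank

/-! Averaging over all subsets keeps each coordinate independently with probability 1/2, so bias
plus variance gives `¼‖UVᵀ - 2M‖² + ¼ ∑ cᵢ²`, where `cᵢ` is the product of the lengths of the `i`-th
columns (`sum_sq_norm_mask`). Dropping the empty set only changes this by a constant and a positive
factor.

Cauchy–Schwarz and `∑ cᵢ ≥ ‖UVᵀ‖_*` bound the expression below by `Phi M (U * Vᵀ)`. The bound is
attained over every product `W`: rotating `P√Σ` and `Q√Σ` by an orthogonal `R` that makes the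
diagonal of `RᵀΣR` constant equalizes the `cᵢ` (`exists_balanced_factorization`). Hence ASL
minimizers multiply to minimizers of `Phi`.

`Phi` is minimized by soft-thresholding the doubled singular values `2σᵢ` at a self-consistent level
`t`. The residual `2M - W` certifies optimality with quadratic growth, hence uniqueness
(`Phi_add_sq_norm_sub_le`). Thresholding fixes `σ` only if all `σᵢ` equal `t`. -/

/-! ### Singular value decomposition. -/

theorem exists_orthonormalBasis_map_eq_singularValues {m n : ℕ}
    (T : EuclideanSpace ℝ (Fin n) →ₗ[ℝ] EuclideanSpace ℝ (Fin m)) :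
    ∃ (b : OrthonormalBasis (Fin n) ℝ (EuclideanSpace ℝ (Fin n)))
      (e : OrthonormalBasis (Fin m) ℝ (EuclideanSpace ℝ (Fin m))),
      (∀ (i : Fin n) (j : Fin m), (i : ℕ) = j → T (b i) = T.singularValues i • e j) ∧
      ∀ i : Fin n, m ≤ i → T (b i) = 0 := by
  have hn : Module.finrank ℝ (EuclideanSpace ℝ (Fin n)) = n := by simp
  have hm : Module.finrank ℝ (EuclideanSpace ℝ (Fin m)) = m := by simp
  set b := T.isSymmetric_adjoint_comp_self.eigenvectorBasis hn
  have hinner : ∀ i j, inner ℝ (T (b i)) (T (b j)) =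
      if i = j then T.singularValues j ^ 2 else 0 := by
    intro i j
    have h : (LinearMap.adjoint T) (T (b j)) = (T.singularValues j ^ 2) • b j := by
      rw [T.sq_singularValues_fin hn]
      exact T.isSymmetric_adjoint_comp_self.apply_eigenvectorBasis hn j
    rw [← LinearMap.adjoint_inner_right, h, inner_smul_right,
      orthonormal_iff_ite.mp b.orthonormal]
    simp
  have hzero : ∀ i : Fin n, T.singularValues i = 0 → T (b i) = 0 := by
    intro i hi
    have := hinner i i
    rwa [if_pos rfl, hi, zero_pow two_ne_zero, inner_self_eq_zero] at this
  have hrn : Module.finrank ℝ T.range ≤ n := T.finrank_range_le.trans hn.le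
  have hrm : Module.finrank ℝ T.range ≤ m := T.range.finrank_le.trans hm.le
  -- Normalized images of the right singular vectors. They are orthonormal only for indices below
  -- the rank, where the default `0` never occurs; the rest of `e` is an arbitrary extension.
  let v : Fin m → EuclideanSpace ℝ (Fin m) := fun j =>
    if h : (j : ℕ) < n then (T.singularValues j)⁻¹ • T (b ⟨j, h⟩) else 0
  let s : Set (Fin m) := {j | (j : ℕ) < Module.finrank ℝ T.range}
  have hv : Orthonormal ℝ (s.domRestrict v) := by
    rw [orthonormal_iff_ite]
    rintro ⟨i, hi⟩ ⟨j, hj⟩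
    have hi' : (i : ℕ) < n := lt_of_lt_of_le hi hrn
    have hj' : (j : ℕ) < n := lt_of_lt_of_le hj hrn
    have hpos := (T.singularValues_pos_iff_lt_finrank_range.mpr hj).ne'
    simp only [Set.domRestrict_apply, v, hi', hj', dif_pos, inner_smul_left, inner_smul_right,
      hinner, Subtype.mk.injEq, Fin.ext_iff]
    split_ifs with h
    · rw [h]
      simp only [conj_trivial]
      field_simp
    · simp
  obtain ⟨e, he⟩ := hv.exists_orthonormalBasis_extension_of_card_eq (by simp)
  refine ⟨b, e, ?_, ?_⟩
  · intro i j hij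
    by_cases h : (i : ℕ) < Module.finrank ℝ T.range
    · have hj : j ∈ s := by simpa [s, ← hij] using h
      have hpos := (T.singularValues_pos_iff_lt_finrank_range.mpr h).ne'
      have hjn : (j : ℕ) < n := hij ▸ i.2
      have hidx : (⟨j, hjn⟩ : Fin n) = i := Fin.ext hij.symm
      rw [he j hj]
      simp only [v, dif_pos hjn, hidx]
      rw [← hij, smul_smul, mul_inv_cancel₀ hpos, one_smul]
    · have h0 := T.singularValues_eq_zero_iff_le_finrank_range.mpr (not_lt.mp h)
      rw [hzero i h0, h0, zero_smul]
  · intro i hi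
    exact hzero i (T.singularValues_eq_zero_iff_le_finrank_range.mpr (hrm.trans hi))

/-- The reduced singular value decomposition. -/
theorem exists_singularValue_decomposition {m n : ℕ} (M : Matrix (Fin m) (Fin n) ℝ) :
    ∃ (P : Matrix (Fin m) (Fin (min m n)) ℝ) (Q : Matrix (Fin n) (Fin (min m n)) ℝ),
      Pᵀ * P = 1 ∧ Qᵀ * Q = 1 ∧
        M = P * diagonal (fun i : Fin (min m n) => singularValue M i) * Qᵀ := by
  obtain ⟨b, e, hbe, hb0⟩ := exists_orthonormalBasis_map_eq_singularValues (toEuclideanLin M)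
  have hm : min m n ≤ m := min_le_left _ _
  have hn : min m n ≤ n := min_le_right _ _
  refine ⟨of fun a i => e (Fin.castLE hm i) a, of fun c i => b (Fin.castLE hn i) c, ?_, ?_, ?_⟩
  · ext i j
    have := orthonormal_iff_ite.mp e.orthonormal (Fin.castLE hm i) (Fin.castLE hm j)
    simp only [PiLp.inner_apply, Fin.castLE_inj] at this
    simpa [mul_apply, one_apply, mul_comm] using this
  · ext i j
    have := orthonormal_iff_ite.mp b.orthonormal (Fin.castLE hn i) (Fin.castLE hn j)
    simp only [PiLp.inner_apply, Fin.castLE_inj] at this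
    simpa [mul_apply, one_apply, mul_comm] using this
  · ext a c
    have h1 : M a c = toEuclideanLin M (EuclideanSpace.single c 1) a := by
      simp [toLpLin_apply]
    have h2 := b.sum_repr' (EuclideanSpace.single c (1 : ℝ))
    rw [h1, ← h2, map_sum, mul_apply]
    simp only [map_smul, WithLp.ofLp_sum, Finset.sum_apply, WithLp.ofLp_smul, Pi.smul_apply,
      smul_eq_mul, EuclideanSpace.inner_single_right, mul_diagonal,
      transpose_apply, of_apply]
    symm
    refine Fintype.sum_of_injective (Fin.castLE hn) (Fin.castLE_injective hn) _ _ ?_ ?_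
    · intro j hj
      have : m ≤ (j : ℕ) := by
        by_contra h
        exact hj ⟨⟨j, lt_min (not_le.mp h) j.2⟩, rfl⟩
      rw [hb0 j this]
      simp
    · intro i
      rw [hbe (Fin.castLE hn i) (Fin.castLE hm i) rfl]
      simp [singularValue]
      ring

/-! ### Frobenius pairing and the cost of a factorization. -/

theorem sq_norm_eq_sum {m n : Type*} [Fintype m] [Fintype n] (A : Matrix m n ℝ) :
    ‖A‖ ^ 2 = ∑ i, ∑ j, A i j ^ 2 := by
  rw [frobenius_norm_def, ← Real.sqrt_eq_rpow, Real.sq_sqrt (by positivity)]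
  simp

theorem sq_norm_eq_trace {m n : Type*} [Fintype m] [Fintype n] (A : Matrix m n ℝ) :
    ‖A‖ ^ 2 = trace (Aᵀ * A) := by
  rw [sq_norm_eq_sum, Finset.sum_comm]
  simp [trace, mul_apply, pow_two]

theorem trace_transpose_mul_comm {m n : Type*} [Fintype m] [Fintype n] (A B : Matrix m n ℝ) :
    trace (Aᵀ * B) = trace (Bᵀ * A) := by
  rw [← trace_transpose, transpose_mul, transpose_transpose]

/-- Bessel's inequality for the orthonormal columns of a matrix. -/
theorem sum_sq_transpose_mulVec_le {m k : Type*} [Fintype m] [Fintype k] [DecidableEq k]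
    (P : Matrix m k ℝ) (hP : Pᵀ * P = 1) (u : m → ℝ) :
    ∑ i, (Pᵀ *ᵥ u) i ^ 2 ≤ ∑ a, u a ^ 2 := by
  have h0 : 0 ≤ (u - P *ᵥ (Pᵀ *ᵥ u)) ⬝ᵥ (u - P *ᵥ (Pᵀ *ᵥ u)) := by
    simp only [dotProduct]
    exact Finset.sum_nonneg fun _ _ => mul_self_nonneg _
  have h1 : (P *ᵥ (Pᵀ *ᵥ u)) ⬝ᵥ u = (Pᵀ *ᵥ u) ⬝ᵥ (Pᵀ *ᵥ u) := by
    rw [dotProduct_mulVec, vecMul_transpose, dotProduct_comm]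
  have h2 : (P *ᵥ (Pᵀ *ᵥ u)) ⬝ᵥ (P *ᵥ (Pᵀ *ᵥ u)) = (Pᵀ *ᵥ u) ⬝ᵥ (Pᵀ *ᵥ u) := by
    rw [dotProduct_mulVec, ← mulVec_transpose, mulVec_mulVec, hP, one_mulVec]
  have h3 : (Pᵀ *ᵥ u) ⬝ᵥ (Pᵀ *ᵥ u) ≤ u ⬝ᵥ u := by
    rw [sub_dotProduct, dotProduct_sub, dotProduct_sub, dotProduct_comm u (P *ᵥ _), h1, h2] at h0
    linarith
  simpa [dotProduct, pow_two] using h3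

/-- The product of the Euclidean lengths of the `j`-th columns of `U` and `V`. -/
noncomputable def colNormMul {m n l : Type*} [Fintype m] [Fintype n] (U : Matrix m l ℝ)
    (V : Matrix n l ℝ) (j : l) : ℝ :=
  √(∑ a, U a j ^ 2) * √(∑ c, V c j ^ 2)

/-- Cauchy–Schwarz, then Bessel, one column of `U` and `V` at a time. Taking `c = 1` bounds the
nuclear norm by the factorization cost; general `c` yields the duality with the operator norm. -/
theorem trace_transpose_mul_le {m n k l : Type*} [Fintype m] [Fintype n] [Fintype k] [Fintype l]
    [DecidableEq k] (P : Matrix m k ℝ) (Q : Matrix n k ℝ) (hP : Pᵀ * P = 1) (hQ : Qᵀ * Q = 1)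
    (c : k → ℝ) (t : ℝ) (ht : 0 ≤ t) (hc : ∀ i, |c i| ≤ t) (U : Matrix m l ℝ) (V : Matrix n l ℝ) :
    trace ((P * diagonal c * Qᵀ)ᵀ * (U * Vᵀ)) ≤ t * ∑ j, colNormMul U V j := by
  have h1 : trace ((P * diagonal c * Qᵀ)ᵀ * (U * Vᵀ)) =
      ∑ j, ∑ i, c i * ((Pᵀ *ᵥ (fun a => U a j)) i * (Qᵀ *ᵥ (fun a => V a j)) i) := by
    have : trace ((P * diagonal c * Qᵀ)ᵀ * (U * Vᵀ)) =
        trace ((Vᵀ * Q) * (diagonal c * (Pᵀ * U))) := by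
      rw [transpose_mul, transpose_mul, transpose_transpose, diagonal_transpose,
        ← Matrix.mul_assoc, trace_mul_comm]
      simp only [Matrix.mul_assoc]
    rw [this, trace]
    refine Finset.sum_congr rfl fun j _ => ?_
    rw [diag_apply, mul_apply]
    refine Finset.sum_congr rfl fun i _ => ?_
    rw [diagonal_mul, mul_apply, mul_apply]
    simp only [mulVec, dotProduct, transpose_apply]
    rw [Finset.sum_congr rfl fun x _ => mul_comm (V x j) (Q x i)]
    ring
  rw [h1, Finset.mul_sum]
  refine Finset.sum_le_sum fun j _ => ?_
  set x := Pᵀ *ᵥ (fun a => U a j)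
  set y := Qᵀ *ᵥ (fun a => V a j)
  calc ∑ i, c i * (x i * y i) ≤ ∑ i, t * (|x i| * |y i|) := by
        refine Finset.sum_le_sum fun i _ => ?_
        refine (le_abs_self _).trans ?_
        rw [abs_mul, abs_mul]
        exact mul_le_mul_of_nonneg_right (hc i) (by positivity)
    _ = t * ∑ i, |x i| * |y i| := by rw [Finset.mul_sum]
    _ ≤ t * (√(∑ i, |x i| ^ 2) * √(∑ i, |y i| ^ 2)) :=
        mul_le_mul_of_nonneg_left (Real.sum_mul_le_sqrt_mul_sqrt _ _ _) ht
    _ ≤ t * colNormMul U V j := by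
        refine mul_le_mul_of_nonneg_left ?_ ht
        simp only [sq_abs]
        exact mul_le_mul (Real.sqrt_le_sqrt (sum_sq_transpose_mulVec_le P hP _))
          (Real.sqrt_le_sqrt (sum_sq_transpose_mulVec_le Q hQ _)) (by positivity) (by positivity)

theorem sum_sq_col {m k : Type*} [Fintype m] (U : Matrix m k ℝ) (j : k) :
    ∑ a, U a j ^ 2 = (Uᵀ * U) j j := by
  simp [mul_apply, pow_two]

theorem colNormMul_mul_diagonal {m n k : Type*} [Fintype m] [Fintype n] [Fintype k]
    [DecidableEq k] {P : Matrix m k ℝ} {Q : Matrix n k ℝ} (hP : Pᵀ * P = 1) (hQ : Qᵀ * Q = 1)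
    {s : k → ℝ} (hs : ∀ i, 0 ≤ s i) (j : k) : colNormMul (P * diagonal s) Q j = s j := by
  rw [colNormMul, sum_sq_col, sum_sq_col, hQ, transpose_mul, Matrix.mul_assoc,
    ← Matrix.mul_assoc Pᵀ, hP]
  simp [Real.sqrt_mul_self (hs j)]

theorem trace_decomposition_mul {m n k : Type*} [Fintype m] [Fintype n] [Fintype k]
    [DecidableEq k] {P : Matrix m k ℝ} {Q : Matrix n k ℝ} (hP : Pᵀ * P = 1) (hQ : Qᵀ * Q = 1)
    (c s : k → ℝ) :
    trace ((P * diagonal c * Qᵀ)ᵀ * (P * diagonal s * Qᵀ)) = ∑ i, c i * s i := by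
  have : trace ((P * diagonal c * Qᵀ)ᵀ * (P * diagonal s * Qᵀ)) =
      trace (Qᵀ * Q * (diagonal c * ((Pᵀ * P) * diagonal s))) := by
    rw [transpose_mul, transpose_mul, transpose_transpose, diagonal_transpose,
      Matrix.mul_assoc Q, trace_mul_comm Q, ← trace_mul_comm _ (Qᵀ * Q)]
    simp only [Matrix.mul_assoc]
  rw [this, hP, hQ, Matrix.one_mul, Matrix.one_mul, diagonal_mul_diagonal, trace_diagonal]

/-- Two matrices with the same singular vectors coincide only if the coefficients do. -/
theorem decomposition_injective {m n k : Type*} [Fintype m] [Fintype n] [Fintype k]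
    [DecidableEq k] {P : Matrix m k ℝ} {Q : Matrix n k ℝ} (hP : Pᵀ * P = 1) (hQ : Qᵀ * Q = 1)
    {c s : k → ℝ} (h : P * diagonal c * Qᵀ = P * diagonal s * Qᵀ) : c = s := by
  have key : ∀ d : k → ℝ, Pᵀ * (P * diagonal d * Qᵀ) * Q = diagonal d := by
    intro d
    rw [← Matrix.mul_assoc, ← Matrix.mul_assoc, hP, Matrix.one_mul, Matrix.mul_assoc, hQ,
      Matrix.mul_one]
  have := key c
  rw [h, key s] at this
  exact (diagonal_injective this).symm

/-! ### The average over subsets. -/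

/-- The sum over all subsets `S` of the square of `∑ i ∈ S, x i - y`. -/
theorem sum_powerset_sq {ι : Type*} [DecidableEq ι] (T : Finset ι) (x : ι → ℝ) (y : ℝ) :
    ∑ S ∈ T.powerset, (∑ i ∈ S, x i - y) ^ 2 =
      2 ^ T.card * ((1 / 4) * (∑ i ∈ T, x i - 2 * y) ^ 2 + (1 / 4) * ∑ i ∈ T, x i ^ 2) := by
  induction T using Finset.induction_on generalizing y with
  | empty => simp; ring
  | insert a T ha ih =>
    rw [Finset.sum_powerset_insert ha, ih]
    -- Adding `a` to `S` shifts the target, which is why the induction generalizes `y`.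
    have : ∀ S ∈ T.powerset, (∑ i ∈ insert a S, x i - y) ^ 2 = (∑ i ∈ S, x i - (y - x a)) ^ 2 := by
      intro S hS
      rw [Finset.sum_insert fun h => ha (Finset.mem_powerset.mp hS h)]
      ring
    rw [Finset.sum_congr rfl this, ih, Finset.sum_insert ha, Finset.sum_insert ha,
      Finset.card_insert_of_notMem ha]
    ring

/-- The scalar identity `sum_powerset_sq` applies entrywise; the variance terms sum to squared
column costs because each rank-one term has factoring entries. -/
theorem sum_sq_norm_mask {m n k : ℕ} (M : Matrix (Fin m) (Fin n) ℝ)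
    (U : Matrix (Fin m) (Fin k) ℝ) (V : Matrix (Fin n) (Fin k) ℝ) :
    ∑ S : Finset (Fin k), ‖U * mask S * Vᵀ - M‖ ^ 2 =
      2 ^ k * ((1 / 4) * ‖U * Vᵀ - (2 : ℝ) • M‖ ^ 2 +
        (1 / 4) * ∑ i, colNormMul U V i ^ 2) := by
  have h1 : ∀ S : Finset (Fin k), ‖U * mask S * Vᵀ - M‖ ^ 2 =
      ∑ a, ∑ c, (∑ i ∈ S, U a i * V c i - M a c) ^ 2 := by
    intro S
    rw [sq_norm_eq_sum]
    refine Finset.sum_congr rfl fun a _ => Finset.sum_congr rfl fun c _ => ?_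
    rw [Matrix.sub_apply, mul_apply]
    simp [mask, mul_diagonal, Finset.sum_ite_mem]
  have h2 : ∀ a c, ∑ S : Finset (Fin k), (∑ i ∈ S, U a i * V c i - M a c) ^ 2 =
      2 ^ k * ((1 / 4) * (∑ i, U a i * V c i - 2 * M a c) ^ 2 +
        (1 / 4) * ∑ i, (U a i * V c i) ^ 2) := by
    intro a c
    have := sum_powerset_sq Finset.univ (fun i => U a i * V c i) (M a c)
    rwa [Finset.powerset_univ, Finset.card_univ, Fintype.card_fin] at this
  have h3 : ∑ i, colNormMul U V i ^ 2 = ∑ a, ∑ c, ∑ i, (U a i * V c i) ^ 2 := by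
    have : ∀ i, colNormMul U V i ^ 2 = ∑ a, ∑ c, (U a i * V c i) ^ 2 := by
      intro i
      rw [colNormMul, mul_pow, Real.sq_sqrt (by positivity), Real.sq_sqrt (by positivity),
        Finset.sum_mul_sum]
      simp only [mul_pow]
    simp only [this]
    rw [Finset.sum_comm]
    refine Finset.sum_congr rfl fun a _ => ?_
    rw [Finset.sum_comm]
  simp only [h1]
  rw [Finset.sum_comm]
  have h4 : ∀ a, ∑ S : Finset (Fin k), ∑ c, (∑ i ∈ S, U a i * V c i - M a c) ^ 2 =
      ∑ c, 2 ^ k * ((1 / 4) * (∑ i, U a i * V c i - 2 * M a c) ^ 2 +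
        (1 / 4) * ∑ i, (U a i * V c i) ^ 2) := by
    intro a
    rw [Finset.sum_comm]
    exact Finset.sum_congr rfl fun c _ => h2 a c
  simp only [h4, h3, sq_norm_eq_sum, Matrix.sub_apply, Matrix.smul_apply, mul_apply, transpose_apply,
    smul_eq_mul, ← Finset.mul_sum, Finset.sum_add_distrib]

theorem aslObjective_eq {m n k : ℕ} (M : Matrix (Fin m) (Fin n) ℝ)
    (U : Matrix (Fin m) (Fin k) ℝ) (V : Matrix (Fin n) (Fin k) ℝ) :
    aslObjective M U V = (1 / ((2 : ℝ) ^ k - 1)) *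
      (2 ^ k * ((1 / 4) * ‖U * Vᵀ - (2 : ℝ) • M‖ ^ 2 +
        (1 / 4) * ∑ i, colNormMul U V i ^ 2) - ‖M‖ ^ 2) := by
  have h := Finset.sum_filter_add_sum_filter_not (Finset.univ : Finset (Finset (Fin k)))
    (fun S => S.Nonempty) (fun S => ‖U * mask S * Vᵀ - M‖ ^ 2)
  have h0 : (Finset.univ : Finset (Finset (Fin k))).filter (fun S => ¬ S.Nonempty) = {∅} := by
    ext S; simp
  have hmask : mask (∅ : Finset (Fin k)) = 0 := by simp [mask]
  rw [h0, Finset.sum_singleton, hmask, sum_sq_norm_mask, Matrix.mul_zero, Matrix.zero_mul,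
    zero_sub, norm_neg] at h
  rw [aslObjective, ← h, add_sub_cancel_right]

/-! ### Orthogonal conjugation to constant diagonal. -/

/-- The reflection in the hyperplane orthogonal to `w`, for a unit vector `w`. -/
def reflectionMatrix {k : Type*} [DecidableEq k] (w : k → ℝ) : Matrix k k ℝ :=
  1 - (2 : ℝ) • vecMulVec w w

theorem transpose_reflectionMatrix {k : Type*} [DecidableEq k] (w : k → ℝ) :
    (reflectionMatrix w)ᵀ = reflectionMatrix w := by
  simp [reflectionMatrix]

theorem reflectionMatrix_mul_self {k : Type*} [Fintype k] [DecidableEq k] (w : k → ℝ)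
    (hw : w ⬝ᵥ w = 1) : reflectionMatrix w * reflectionMatrix w = 1 := by
  have h : vecMulVec w w * vecMulVec w w = vecMulVec w w := by
    rw [vecMulVec_mul_vecMulVec, hw, one_smul]
  rw [reflectionMatrix, Matrix.sub_mul, Matrix.mul_sub, Matrix.mul_sub, Matrix.one_mul,
    Matrix.mul_one, Matrix.one_mul, Matrix.smul_mul, Matrix.mul_smul, h]
  module

/-- The vector `e_l - 2 w_l w` is the image of `e_l`. When `w l = 0` it is `e_l` itself, so that
diagonal entry is untouched. -/
theorem reflectionMatrix_conj_apply {k : Type*} [Fintype k] [DecidableEq k] (w : k → ℝ)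
    (S : Matrix k k ℝ) (l : k) :
    (reflectionMatrix w * S * reflectionMatrix w) l l =
      (Pi.single l 1 - (2 * w l) • w) ⬝ᵥ (S *ᵥ (Pi.single l 1 - (2 * w l) • w)) := by
  have h : reflectionMatrix w *ᵥ Pi.single l 1 = Pi.single l 1 - (2 * w l) • w := by
    ext i
    simp [reflectionMatrix, vecMulVec_apply, one_apply, Pi.single_apply]
    ring
  calc (reflectionMatrix w * S * reflectionMatrix w) l l
      = Pi.single l 1 ⬝ᵥ ((reflectionMatrix w * S * reflectionMatrix w) *ᵥ Pi.single l 1) := by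
        simp
    _ = (reflectionMatrix w *ᵥ Pi.single l 1) ⬝ᵥ
        (S *ᵥ (reflectionMatrix w *ᵥ Pi.single l 1)) := by
        rw [← mulVec_mulVec, ← mulVec_mulVec, dotProduct_mulVec, ← mulVec_transpose,
          transpose_reflectionMatrix]
    _ = _ := by rw [h]

/-- Every real square matrix is orthogonally similar to one with constant diagonal. -/
theorem exists_orthogonal_conj_diag_const {k : Type*} [Fintype k] [DecidableEq k]
    (S : Matrix k k ℝ) :
    ∃ R : Matrix k k ℝ, R * Rᵀ = 1 ∧ ∀ i, (Rᵀ * S * R) i i = trace S / Fintype.card k := by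
  classical
  set μ := trace S / Fintype.card k with hμ
  -- Extremal argument: an `R` with the most diagonal entries equal to the mean must have all of
  -- them equal to it.
  let good : Matrix k k ℝ → Finset k := fun R => Finset.univ.filter fun i => (Rᵀ * S * R) i i = μ
  let counts : Set ℕ := {c | ∃ R : Matrix k k ℝ, R * Rᵀ = 1 ∧ (good R).card = c}
  have hne : counts.Nonempty := ⟨_, 1, by simp, rfl⟩
  have hbdd : BddAbove counts := ⟨Fintype.card k, by
    rintro _ ⟨R, -, rfl⟩
    exact Finset.card_le_univ _⟩
  obtain ⟨R, hR, hcard⟩ := Nat.sSup_mem hne hbdd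
  have hmax : ∀ R' : Matrix k k ℝ, R' * R'ᵀ = 1 → (good R').card ≤ (good R).card := by
    intro R' hR'
    rw [hcard]
    exact le_csSup hbdd ⟨R', hR', rfl⟩
  refine ⟨R, hR, ?_⟩
  by_contra! hcon
  obtain ⟨i₀, hi₀⟩ := hcon
  set A := Rᵀ * S * R with hA
  have htr : ∑ i, (A i i - μ) = 0 := by
    have h1 : ∑ i, A i i = trace S := by
      change trace A = _
      rw [hA, trace_mul_comm, ← Matrix.mul_assoc, hR, Matrix.one_mul]
    have : (Fintype.card k : ℝ) ≠ 0 := by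
      have : Nonempty k := ⟨i₀⟩
      exact_mod_cast Fintype.card_ne_zero
    rw [Finset.sum_sub_distrib, h1]
    simp only [Finset.sum_const, Finset.card_univ, nsmul_eq_mul, hμ]
    field_simp
    simp
  obtain ⟨i, hi⟩ : ∃ i, A i i < μ := by
    by_contra! h
    have := (Finset.sum_eq_zero_iff_of_nonneg fun i _ => sub_nonneg.mpr (h i)).mp htr i₀
      (Finset.mem_univ _)
    exact hi₀ (by linarith)
  obtain ⟨j, hj⟩ : ∃ j, μ < A j j := by
    by_contra! h
    have := (Finset.sum_eq_zero_iff_of_nonpos fun i _ => sub_nonpos.mpr (h i)).mp htr i₀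
      (Finset.mem_univ _)
    exact hi₀ (by linarith)
  have hij : i ≠ j := by rintro rfl; linarith
  -- At `θ = π/2` the reflection fixes `e_i`, at `π/4` it sends `e_i` to `-e_j`. The `i`-th diagonal
  -- entry thus moves continuously from `A i i` to `A j j`, crossing `μ`.
  let w : ℝ → k → ℝ := fun θ => Pi.single i (Real.cos θ) + Pi.single j (Real.sin θ)
  have hw : ∀ θ, w θ ⬝ᵥ w θ = 1 := by
    intro θ
    simp [w, hij, hij.symm, ← pow_two]
  have hcont : Continuous fun θ => (reflectionMatrix (w θ) * A * reflectionMatrix (w θ)) i i := by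
    have hwc : ∀ l, Continuous fun θ => w θ l := by
      intro l
      simp only [w, Pi.add_apply, Pi.single_apply]
      split_ifs <;> fun_prop
    simp only [reflectionMatrix_conj_apply, dotProduct, mulVec, Pi.sub_apply, Pi.smul_apply,
      smul_eq_mul]
    fun_prop
  have h0 : (reflectionMatrix (w (Real.pi / 2)) * A * reflectionMatrix (w (Real.pi / 2))) i i
      = A i i := by
    rw [reflectionMatrix_conj_apply]
    simp [w, hij]
  have h1 : (reflectionMatrix (w (Real.pi / 4)) * A * reflectionMatrix (w (Real.pi / 4))) i i
      = A j j := by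
    have : (Pi.single i 1 - (2 * w (Real.pi / 4) i) • w (Real.pi / 4)) = -Pi.single j (1 : ℝ) := by
      have h2 : √2 * √2 = (2 : ℝ) := by norm_num
      ext l
      rcases eq_or_ne l i with rfl | hl
      · simp [w, hij]
        linarith
      · rcases eq_or_ne l j with rfl | hl'
        · simp [w, hij, hl]
          linarith
        · simp [w, hl, hl']
    rw [reflectionMatrix_conj_apply, this, mulVec_neg, neg_dotProduct_neg]
    simp
  obtain ⟨θ, -, hθ⟩ : μ ∈ (fun θ => (reflectionMatrix (w θ) * A * reflectionMatrix (w θ)) i i) ''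
      Set.uIcc (Real.pi / 2) (Real.pi / 4) := by
    refine intermediate_value_uIcc hcont.continuousOn ?_
    rw [h0, h1]
    exact Set.mem_uIcc_of_le hi.le hj.le
  have hR' : (R * reflectionMatrix (w θ)) * (R * reflectionMatrix (w θ))ᵀ = 1 := by
    rw [transpose_mul, transpose_reflectionMatrix, Matrix.mul_assoc,
      ← Matrix.mul_assoc (reflectionMatrix _), reflectionMatrix_mul_self _ (hw θ), Matrix.one_mul,
      hR]
  have hconj : (R * reflectionMatrix (w θ))ᵀ * S * (R * reflectionMatrix (w θ)) =
      reflectionMatrix (w θ) * A * reflectionMatrix (w θ) := by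
    rw [transpose_mul, transpose_reflectionMatrix, hA]
    simp only [Matrix.mul_assoc]
  have hlt : good R ⊂ good (R * reflectionMatrix (w θ)) := by
    rw [Finset.ssubset_iff_of_subset]
    · refine ⟨i, ?_, ?_⟩
      · simpa only [good, Finset.mem_filter, Finset.mem_univ, true_and, hconj] using hθ
      · simpa only [good, Finset.mem_filter, Finset.mem_univ, true_and] using hi.ne
    · intro l hl
      simp only [good, Finset.mem_filter, Finset.mem_univ, true_and, hconj] at hl ⊢
      have hli : l ≠ i := by rintro rfl; exact hi.ne hl
      have hlj : l ≠ j := by rintro rfl; exact hj.ne' hl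
      have hwl : w θ l = 0 := by simp [w, hli, hlj]
      rw [reflectionMatrix_conj_apply, hwl, ← hl]
      simp [hA]
  exact absurd (hmax _ hR') (not_le.mpr (Finset.card_lt_card hlt))

/-! ### Nuclear norm and duality. -/

theorem singularValue_nonneg {m n : ℕ} (A : Matrix (Fin m) (Fin n) ℝ) (i : ℕ) :
    0 ≤ singularValue A i :=
  LinearMap.singularValues_nonneg _ i

theorem nuclearNorm_eq_sum_fin {m n : ℕ} (A : Matrix (Fin m) (Fin n) ℝ) :
    nuclearNorm A = ∑ i : Fin (min m n), singularValue A i :=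
  Finset.sum_range _

theorem nuclearNorm_nonneg {m n : ℕ} (A : Matrix (Fin m) (Fin n) ℝ) : 0 ≤ nuclearNorm A :=
  Finset.sum_nonneg fun _ _ => singularValue_nonneg _ _

/-- The nuclear norm is at most the cost of any factorization. -/
theorem nuclearNorm_mul_transpose_le {m n : ℕ} {l : Type*} [Fintype l] (U : Matrix (Fin m) l ℝ)
    (V : Matrix (Fin n) l ℝ) : nuclearNorm (U * Vᵀ) ≤ ∑ j, colNormMul U V j := by
  obtain ⟨P, Q, hP, hQ, hW⟩ := exists_singularValue_decomposition (U * Vᵀ)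
  have h := trace_transpose_mul_le P Q hP hQ (fun _ => 1) 1 zero_le_one (by simp) U V
  rw [hW, trace_decomposition_mul hP hQ, one_mul] at h
  rw [nuclearNorm_eq_sum_fin]
  simpa using h

/-- The operator norm and the nuclear norm are dual to one another. -/
theorem trace_transpose_mul_le_nuclearNorm {m n : ℕ} {k : Type*} [Fintype k] [DecidableEq k]
    {P : Matrix (Fin m) k ℝ} {Q : Matrix (Fin n) k ℝ} (hP : Pᵀ * P = 1) (hQ : Qᵀ * Q = 1)
    {c : k → ℝ} {t : ℝ} (ht : 0 ≤ t) (hc : ∀ i, |c i| ≤ t) (W : Matrix (Fin m) (Fin n) ℝ) :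
    trace ((P * diagonal c * Qᵀ)ᵀ * W) ≤ t * nuclearNorm W := by
  obtain ⟨P', Q', hP', hQ', hW⟩ := exists_singularValue_decomposition W
  have h := trace_transpose_mul_le P Q hP hQ c t ht hc
    (P' * diagonal (fun i : Fin (min m n) => singularValue W i)) Q'
  rw [← hW] at h
  refine h.trans_eq ?_
  rw [nuclearNorm_eq_sum_fin]
  congr 1
  exact Finset.sum_congr rfl fun j _ =>
    colNormMul_mul_diagonal hP' hQ' (fun i => singularValue_nonneg W i) j

theorem nuclearNorm_decomposition_le {m n : ℕ} {k : Type*} [Fintype k] [DecidableEq k]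
    {P : Matrix (Fin m) k ℝ} {Q : Matrix (Fin n) k ℝ} (hP : Pᵀ * P = 1) (hQ : Qᵀ * Q = 1)
    {s : k → ℝ} (hs : ∀ i, 0 ≤ s i) : nuclearNorm (P * diagonal s * Qᵀ) ≤ ∑ i, s i :=
  (nuclearNorm_mul_transpose_le _ _).trans_eq <|
    Finset.sum_congr rfl fun j _ => colNormMul_mul_diagonal hP hQ hs j

/-! ### Minimizing `Phi` by soft-thresholding. -/

/-- The threshold `t` of the soft-thresholding that minimizes `Phi`. -/
theorem exists_threshold {k : Type*} [Fintype k] (s : k → ℝ) (hs : ∀ i, 0 ≤ s i) :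
    ∃ t, 0 ≤ t ∧ ∑ i, max (2 * s i - t) 0 = Fintype.card k * t := by
  have hsum : ∀ i, s i ≤ ∑ j, s j := fun i =>
    Finset.single_le_sum (fun j _ => hs j) (Finset.mem_univ i)
  have hS : 0 ≤ ∑ j, s j := Finset.sum_nonneg fun j _ => hs j
  have hcont : Continuous fun t : ℝ => ∑ i, max (2 * s i - t) 0 - Fintype.card k * t := by
    fun_prop
  -- The difference is nonnegative at `0`; at `2 * ∑ s` every positive part vanishes.
  obtain ⟨t, ht, h⟩ := intermediate_value_Icc' (a := 0) (b := 2 * ∑ j, s j) (by positivity)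
    hcont.continuousOn (show (0 : ℝ) ∈ Set.Icc _ _ by
      constructor
      · have : ∀ i, max (2 * s i - 2 * ∑ j, s j) 0 = 0 := fun i =>
          max_eq_right (by linarith [hsum i])
        simp only [this, Finset.sum_const_zero, zero_sub, Left.neg_nonpos_iff]
        positivity
      · simp only [mul_zero, sub_zero]
        exact Finset.sum_nonneg fun i _ => le_max_right _ _)
  exact ⟨t, ht.1, sub_eq_zero.mp h⟩

theorem Phi_add_sq_norm_sub_le {m n : ℕ} {P : Matrix (Fin m) (Fin (min m n)) ℝ}
    {Q : Matrix (Fin n) (Fin (min m n)) ℝ} (hP : Pᵀ * P = 1) (hQ : Qᵀ * Q = 1)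
    (hk : 0 < min m n) {s : Fin (min m n) → ℝ} (hs : ∀ i, 0 ≤ s i) {t : ℝ} (ht : 0 ≤ t)
    (hst : ∑ i, max (2 * s i - t) 0 = (min m n : ℕ) * t) (W' : Matrix (Fin m) (Fin n) ℝ) :
    Phi (P * diagonal s * Qᵀ) (P * diagonal (fun i => max (2 * s i - t) 0) * Qᵀ) +
        (1 / 4) * ‖W' - P * diagonal (fun i => max (2 * s i - t) 0) * Qᵀ‖ ^ 2 ≤
      Phi (P * diagonal s * Qᵀ) W' := by
  set M := P * diagonal s * Qᵀ with hM
  set W := P * diagonal (fun i => max (2 * s i - t) 0) * Qᵀ with hW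
  set K : ℝ := ((min m n : ℕ) : ℝ) with hK
  have hK0 : 0 < K := Nat.cast_pos.mpr hk
  -- The dual certificate `2M - W`: its coefficients lie in `[0, t]`, and equal `t` wherever that of
  -- `W` is nonzero.
  set Y := P * diagonal (fun i => min (2 * s i) t) * Qᵀ with hY
  have hYW : (2 : ℝ) • M - W = Y := by
    rw [hM, hW, hY, ← Matrix.smul_mul, ← Matrix.mul_smul, ← Matrix.sub_mul, ← Matrix.mul_sub,
      ← diagonal_smul, diagonal_sub]
    congr 3
    ext i
    simp only [Pi.smul_apply, smul_eq_mul]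
    rcases le_total (2 * s i) t with h | h
    · rw [max_eq_right (by linarith), min_eq_left h, sub_zero]
    · rw [max_eq_left (by linarith), min_eq_right h]
      ring
  have hN : nuclearNorm W ≤ K * t :=
    (nuclearNorm_decomposition_le hP hQ fun i => le_max_right _ _).trans_eq hst
  have hYW' : trace (Yᵀ * W') ≤ t * nuclearNorm W' := by
    refine trace_transpose_mul_le_nuclearNorm hP hQ ht (fun i => ?_) W'
    rw [abs_of_nonneg (le_min (by linarith [hs i]) ht)]
    exact min_le_right _ _
  have hYWt : trace (Yᵀ * W) = t * (K * t) := by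
    rw [hY, hW, trace_decomposition_mul hP hQ, ← hst, Finset.mul_sum]
    refine Finset.sum_congr rfl fun i _ => ?_
    rcases le_total (2 * s i) t with h | h
    · rw [max_eq_right (by linarith), mul_zero, mul_zero]
    · rw [min_eq_right h]
  have hexp : ‖W' - (2 : ℝ) • M‖ ^ 2 = ‖W - (2 : ℝ) • M‖ ^ 2 + ‖W' - W‖ ^ 2
      - 2 * (trace (Yᵀ * W') - trace (Yᵀ * W)) := by
    have h1 : W' - (2 : ℝ) • M = (W' - W) - Y := by rw [← hYW]; abel
    have h2 : W - (2 : ℝ) • M = -Y := by rw [← hYW]; abel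
    rw [h1, h2, norm_neg, sq_norm_eq_trace (W' - W - Y), sq_norm_eq_trace Y,
      sq_norm_eq_trace (W' - W), transpose_sub, Matrix.sub_mul, Matrix.mul_sub (W' - W)ᵀ,
      Matrix.mul_sub Yᵀ, trace_sub, trace_sub, trace_sub, trace_transpose_mul_comm (W' - W) Y,
      Matrix.mul_sub Yᵀ, trace_sub]
    ring
  have hsq : nuclearNorm W ^ 2 ≤ (K * t) ^ 2 := pow_le_pow_left₀ (nuclearNorm_nonneg W) hN 2
  -- Tangent line to `x ^ 2` at `K * t`; its slope, scaled by `1 / (4 * K)`, cancels the cross term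
  -- in `hexp`.
  have hquad : (K * t) ^ 2 + 2 * K * t * (nuclearNorm W' - K * t) ≤ nuclearNorm W' ^ 2 := by
    nlinarith [sq_nonneg (nuclearNorm W' - K * t)]
  have hdiv : 1 / (4 * K) * nuclearNorm W ^ 2 + (1 / 2) * (t * nuclearNorm W' - t * (K * t)) ≤
      1 / (4 * K) * nuclearNorm W' ^ 2 := by
    have h1 : (1 / 2) * (t * nuclearNorm W' - t * (K * t)) =
        1 / (4 * K) * (2 * K * t * (nuclearNorm W' - K * t)) := by
      field_simp
      ring
    rw [h1, ← mul_add]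
    exact mul_le_mul_of_nonneg_left (by linarith) (by positivity)
  simp only [Phi, ← hK]
  rw [hexp]
  linarith

/-! ### From factorizations to `Phi`. -/

theorem Phi_le_factorization {m n : ℕ} (M : Matrix (Fin m) (Fin n) ℝ)
    (U : Matrix (Fin m) (Fin (min m n)) ℝ) (V : Matrix (Fin n) (Fin (min m n)) ℝ) :
    Phi M (U * Vᵀ) ≤ (1 / 4) * ‖U * Vᵀ - (2 : ℝ) • M‖ ^ 2 +
      (1 / 4) * ∑ i, colNormMul U V i ^ 2 := by
  rcases Nat.eq_zero_or_pos (min m n) with hk | hk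
  · simp only [Phi, hk, Nat.cast_zero, mul_zero, div_zero, zero_mul, add_zero,
      le_add_iff_nonneg_right]
    positivity
  have hK0 : (0 : ℝ) < ((min m n : ℕ) : ℝ) := by exact_mod_cast hk
  have h1 : nuclearNorm (U * Vᵀ) ^ 2 ≤ (∑ i, colNormMul U V i) ^ 2 :=
    pow_le_pow_left₀ (nuclearNorm_nonneg _) (nuclearNorm_mul_transpose_le U V) 2
  have h2 : (∑ i, colNormMul U V i) ^ 2 ≤ ((min m n : ℕ) : ℝ) * ∑ i, colNormMul U V i ^ 2 := by
    simpa using sq_sum_le_card_mul_sum_sq (s := Finset.univ) (f := colNormMul U V)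
  have h3 : 1 / (4 * ((min m n : ℕ) : ℝ)) * nuclearNorm (U * Vᵀ) ^ 2 ≤
      (1 / 4) * ∑ i, colNormMul U V i ^ 2 := by
    calc _ ≤ 1 / (4 * ((min m n : ℕ) : ℝ)) *
          (((min m n : ℕ) : ℝ) * ∑ i, colNormMul U V i ^ 2) :=
          mul_le_mul_of_nonneg_left (h1.trans h2) (by positivity)
      _ = _ := by field_simp
  simp only [Phi]
  linarith

/-- Every matrix has a balanced factorization, all of whose columns have the same cost. -/
theorem exists_balanced_factorization {m n : ℕ} (W : Matrix (Fin m) (Fin n) ℝ) :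
    ∃ (U : Matrix (Fin m) (Fin (min m n)) ℝ) (V : Matrix (Fin n) (Fin (min m n)) ℝ),
      U * Vᵀ = W ∧ ∀ i, colNormMul U V i = nuclearNorm W / (min m n : ℕ) := by
  obtain ⟨P, Q, hP, hQ, hW⟩ := exists_singularValue_decomposition W
  set s : Fin (min m n) → ℝ := fun i => singularValue W i
  -- Both factors will have Gram matrix `Rᵀ * diagonal s * R`, so a constant diagonal equalizes all
  -- column lengths.
  obtain ⟨R, hR, hdiag⟩ := exists_orthogonal_conj_diag_const (diagonal s)
  have hroot : diagonal (fun i => √(s i)) * diagonal (fun i => √(s i)) = diagonal s := by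
    rw [diagonal_mul_diagonal]
    congr 1
    ext i
    exact Real.mul_self_sqrt (singularValue_nonneg W i)
  have hcol : ∀ {p : ℕ} (X : Matrix (Fin p) (Fin (min m n)) ℝ), Xᵀ * X = 1 →
      (X * diagonal (fun i => √(s i)) * R)ᵀ * (X * diagonal (fun i => √(s i)) * R) =
        Rᵀ * diagonal s * R := by
    intro p X hX
    rw [← hroot, transpose_mul, transpose_mul, diagonal_transpose]
    simp only [Matrix.mul_assoc]
    rw [← Matrix.mul_assoc Xᵀ, hX, Matrix.one_mul]
  refine ⟨P * diagonal (fun i => √(s i)) * R, Q * diagonal (fun i => √(s i)) * R, ?_, ?_⟩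
  · rw [transpose_mul, transpose_mul, diagonal_transpose, Matrix.mul_assoc,
      ← Matrix.mul_assoc R, hR, Matrix.one_mul, ← Matrix.mul_assoc, Matrix.mul_assoc P, hroot, ← hW]
  · intro i
    rw [colNormMul, sum_sq_col, sum_sq_col, hcol P hP, hcol Q hQ, hdiag, trace_diagonal,
      nuclearNorm_eq_sum_fin, Fintype.card_fin]
    exact Real.mul_self_sqrt (div_nonneg
      (Finset.sum_nonneg fun i _ => singularValue_nonneg W i) (Nat.cast_nonneg _))

/-- A factorization minimizing the all-subspaces-learning objective multiplies to a minimizer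
of `Phi`. -/
theorem IsASLMinimizer.isPhiMinimizer {m n : ℕ} {M : Matrix (Fin m) (Fin n) ℝ}
    (hk : 0 < min m n) {U : Matrix (Fin m) (Fin (min m n)) ℝ}
    {V : Matrix (Fin n) (Fin (min m n)) ℝ} (h : IsASLMinimizer M U V) :
    IsPhiMinimizer M (U * Vᵀ) := by
  intro W
  obtain ⟨U', V', hUV, hcol⟩ := exists_balanced_factorization W
  have hle := h U' V'
  have hpow : (1 : ℝ) < 2 ^ min m n := one_lt_pow₀ one_lt_two hk.ne'
  rw [aslObjective_eq, aslObjective_eq,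
    mul_le_mul_iff_right₀ (one_div_pos.mpr (sub_pos.mpr hpow)), sub_le_sub_iff_right,
    mul_le_mul_iff_right₀ (by positivity), hUV] at hle
  refine (Phi_le_factorization M U V).trans (hle.trans_eq ?_)
  have hK0 : (0 : ℝ) < ((min m n : ℕ) : ℝ) := by exact_mod_cast hk
  simp only [hcol, Phi, Finset.sum_const, Finset.card_univ, Fintype.card_fin, nsmul_eq_mul]
  field_simp

/-! ### When the minimizer is the target. -/

/-- Soft-thresholding fixes all the entries exactly when they are equal. -/
theorem threshold_fixed_iff {k : Type*} [Fintype k] [Nonempty k] {s : k → ℝ}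
    (hs : ∀ i, 0 ≤ s i) {t : ℝ} (ht : 0 ≤ t)
    (hst : ∑ i, max (2 * s i - t) 0 = Fintype.card k * t) :
    (fun i => max (2 * s i - t) 0) = s ↔ ∀ i j, s i = s j := by
  have hcard : (0 : ℝ) < Fintype.card k := by exact_mod_cast Fintype.card_pos
  constructor
  · intro h
    have hle : ∀ i, s i ≤ t := by
      intro i
      have : max (2 * s i - t) 0 = s i := congrFun h i
      by_contra! hlt
      rw [max_eq_left (by linarith)] at this
      linarith
    -- At a fixed point the threshold equation says that the mean of `s` is its upper bound `t`.
    have hsum : ∑ i, (t - s i) = 0 := by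
      rw [h] at hst
      rw [Finset.sum_sub_distrib, hst]
      simp
    have heq := (Finset.sum_eq_zero_iff_of_nonneg fun i _ => sub_nonneg.mpr (hle i)).mp hsum
    intro i j
    linarith [heq i (Finset.mem_univ _), heq j (Finset.mem_univ _)]
  · intro h
    obtain ⟨i₀⟩ := ‹Nonempty k›
    have hall : ∀ i, max (2 * s i - t) 0 = max (2 * s i₀ - t) 0 := fun i => by rw [h i i₀]
    have h1 : max (2 * s i₀ - t) 0 = t := by
      simp only [hall, Finset.sum_const, Finset.card_univ, nsmul_eq_mul] at hst
      exact mul_left_cancel₀ hcard.ne' hst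
    have h2 : s i₀ = t := by
      rcases le_total (2 * s i₀ - t) 0 with h0 | h0
      · rw [max_eq_right h0] at h1
        linarith [hs i₀]
      · rw [max_eq_left h0] at h1
        linarith
    ext i
    rw [hall, h1, h i i₀, h2]

/-- The unique minimizer of `Phi`, and when it is the target. -/
theorem exists_unique_minimizer {m n : ℕ} (M : Matrix (Fin m) (Fin n) ℝ) (hk : 0 < min m n) :
    ∃ W, IsPhiMinimizer M W ∧ (∀ W', IsPhiMinimizer M W' → W' = W) ∧
      (W = M ↔ ∀ i < min m n, ∀ j < min m n, singularValue M i = singularValue M j) := by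
  have : Nonempty (Fin (min m n)) := ⟨⟨0, hk⟩⟩
  obtain ⟨P, Q, hP, hQ, hM⟩ := exists_singularValue_decomposition M
  have hs : ∀ i : Fin (min m n), 0 ≤ singularValue M i := fun i => singularValue_nonneg M i
  obtain ⟨t, ht, hst⟩ := exists_threshold (fun i : Fin (min m n) => singularValue M i) hs
  have hfix := threshold_fixed_iff hs ht hst
  rw [Fintype.card_fin] at hst
  have key := Phi_add_sq_norm_sub_le hP hQ hk hs ht hst
  rw [← hM] at key
  refine ⟨P * diagonal (fun i : Fin (min m n) => max (2 * singularValue M i - t) 0) * Qᵀ,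
    fun W' => ?_, fun W' hW' => ?_, ?_⟩
  · exact (le_add_of_nonneg_right (by positivity)).trans (key W')
  · have h1 := hW' (P * diagonal (fun i : Fin (min m n) => max (2 * singularValue M i - t) 0) * Qᵀ)
    have h2 := key W'
    have h3 : ‖W' - P * diagonal (fun i : Fin (min m n) =>
        max (2 * singularValue M i - t) 0) * Qᵀ‖ ^ 2 ≤ 0 := by linarith
    exact sub_eq_zero.mp (norm_eq_zero.mp (pow_eq_zero_iff two_ne_zero |>.mp
      (le_antisymm h3 (by positivity))))
  · refine Iff.trans ⟨fun h => decomposition_injective hP hQ (h.trans hM), fun h => ?_⟩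
      (hfix.trans ⟨fun h i hi j hj => h ⟨i, hi⟩ ⟨j, hj⟩, fun h i j => h i i.2 j j.2⟩)
    rw [h, ← hM]

theorem subsingleton_matrix_of_min_eq_zero {m n : ℕ} (h : min m n = 0) :
    Subsingleton (Matrix (Fin m) (Fin n) ℝ) := by
  rcases Nat.min_eq_zero_iff.mp h with rfl | rfl <;> infer_instance

end ElasticRank

theorem theoremB5 (m n : ℕ) (M : Matrix (Fin m) (Fin n) ℝ) :
    (∃! W : Matrix (Fin m) (Fin n) ℝ, ElasticRank.IsPhiMinimizer M W) ∧
    ∀ W : Matrix (Fin m) (Fin n) ℝ, ElasticRank.IsPhiMinimizer M W →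
      (W = M ↔ ∀ i < min m n, ∀ j < min m n,
        ElasticRank.singularValue M i = ElasticRank.singularValue M j) ∧
      (∀ (U : Matrix (Fin m) (Fin (min m n)) ℝ) (V : Matrix (Fin n) (Fin (min m n)) ℝ),
        ElasticRank.IsASLMinimizer M U V →
          ‖U * V.transpose - M‖ ^ 2 = ‖W - M‖ ^ 2 ∧
          (2 ≤ min m n →
            (∀ i j : ℕ, i < j → j < min m n →
              ElasticRank.singularValue M j < ElasticRank.singularValue M i) →
            0 < ‖U * V.transpose - M‖ ^ 2)) := by
  -- With an empty dimension there is only one matrix and everything is trivial.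
  rcases Nat.eq_zero_or_pos (min m n) with hk | hk
  · have := ElasticRank.subsingleton_matrix_of_min_eq_zero hk
    refine ⟨⟨M, fun W => by rw [Subsingleton.elim W M], fun _ _ => Subsingleton.elim _ _⟩,
      fun W _ => ⟨⟨fun _ i hi => by omega, fun _ => Subsingleton.elim _ _⟩, fun U V _ =>
        ⟨by rw [Subsingleton.elim (U * V.transpose) W], fun h => by omega⟩⟩⟩
  · obtain ⟨W₀, hW₀, huniq, hiff⟩ := ElasticRank.exists_unique_minimizer M hk
    refine ⟨⟨W₀, hW₀, huniq⟩, fun W hW => ?_⟩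
    obtain rfl := huniq W hW
    refine ⟨hiff, fun U V hUV => ?_⟩
    rw [huniq _ (hUV.isPhiMinimizer hk)]
    refine ⟨rfl, fun h2 hlt => ?_⟩
    have hne : W ≠ M := fun h =>
      (hlt 0 1 one_pos h2).ne (hiff.mp h 1 h2 0 hk)
    have := norm_pos_iff.mpr (sub_ne_zero.mpr hne)
    positivity
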